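/- Let $\mathbb{K}\in\{\mathbb{R},\mathbb{C}\}$ and let $f\in\mathbb{K}[[x]]^n$, $x=(x_1,\dots,x_n)$, be a formal vector field with $f(0)=0$. Let $B_s\in\mathbb{K}^{n\times n}$ be the semi-simple part of $Df(0)$ in its Jordan–Chevalley decomposition. For a formal vector field $g$ and $\psi\in\mathbb{K}[[x]]$ put $L_g(\psi)=\sum_i g_i\,\partial\psi/\partial x_i$, and write $L_{B_s}$ for $L_g$ with $g(x)=B_sx$. Assume that $f$ is in Poincaré–Dulac normal form, i.e. $[f,B_s](x)=B_s\cdot f(x)-Df(x)\cdot B_sx=0$. Let $I\subseteq\mathbb{K}[[x]]$ be an ideal that is $L_f$-invariant, i.e. $L_f(I)\subseteq I$. Then $I$ is $L_{B_s}$-invariant, i.e. $L_{B_s}(I)\subseteq I$. Consequently $I$ is, after complexification if necessary, generated by semi-invariants of $B_s$: (a) If all eigenvalues of $B_s$ lie in $\mathbb{K}$ (which is automatic for $\mathbb{K}=\mathbb{C}$), then there exist finitely many $\varphi_1,\dots,\varphi_m\in\mathbb{K}[[x]]$ and $\nu_1,\dots,\nu_m\in\mathbb{K}[x]$ with $I=\langle\varphi_1,\dots,\varphi_m\rangle_{\mathbb{K}[[x]]}$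 and $L_{B_s}(\varphi_j)=\nu_j\varphi_j$ for $1\le j\le m$. (b) In every case, for each field embedding $\sigma:\mathbb{K}\to\mathbb{C}$, applying $\sigma$ to all coefficients, the ideal of $\mathbb{C}[[x]]$ generated by the image of $I$ is generated by finitely many $\varphi_1,\dots,\varphi_m\in\mathbb{C}[[x]]$ for which there exist $\nu_1,\dots,\nu_m\in\mathbb{C}[x]$ with $L_{\sigma(B_s)}(\varphi_j)=\nu_j\varphi_j$ for $1\le j\le m$. -/

import Mathlib

noncomputable section

namespace FormalVF

/-- Formal vector fields in `n` variables: elements of `K[[x]]^n`. -/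
abbrev VectorField (n : ℕ) (K : Type*) := Fin n → MvPowerSeries (Fin n) K

variable {n : ℕ} {K : Type*} [Field K]

/-- The formal Lie derivative `L_f(ψ) = Dψ(x) · f(x) = ∑ᵢ fᵢ · ∂ψ/∂xᵢ`. -/
def lieDeriv (f : VectorField n K) (ψ : MvPowerSeries (Fin n) K) : MvPowerSeries (Fin n) K :=
  ∑ i, f i * MvPowerSeries.pderiv K i ψ

/-- The Lie bracket `[f, g] = Dg(x) · f(x) - Df(x) · g(x)`. -/
def lieBracket (f g : VectorField n K) : VectorField n K :=
  fun i => lieDeriv f (g i) - lieDeriv g (f i)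

/-- The linear vector field `x ↦ B x`. -/
def linearField (B : Matrix (Fin n) (Fin n) K) : VectorField n K :=
  fun i => ∑ j, MvPowerSeries.C (B i j) * MvPowerSeries.X j

/-- The Jacobian matrix `Df(0)`. -/
def jacobianAtZero (f : VectorField n K) : Matrix (Fin n) (Fin n) K :=
  Matrix.of fun i j => MvPowerSeries.constantCoeff (MvPowerSeries.pderiv K j (f i))

/-- `Bs` is the semi-simple part of `B` in the Jordan-Chevalley decomposition: `Bs` is semi-simple,
`B - Bs` is nilpotent, and the two commute. (Such a `Bs` exists and is unique over a perfect
field.) -/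
structure IsSemisimplePart (B Bs : Matrix (Fin n) (Fin n) K) : Prop where
  semisimple : Module.End.IsSemisimple (Matrix.toLin' Bs)
  nilpotent : IsNilpotent (B - Bs)
  commute : Commute (B - Bs) Bs

/-- `f` is in Poincaré-Dulac normal form, where `Bs` is the semi-simple part of `Df(0)`. The
origin is a stationary point of `f`. -/
structure IsPDNF (f : VectorField n K) (Bs : Matrix (Fin n) (Fin n) K) : Prop where
  stationary : ∀ i, MvPowerSeries.constantCoeff (f i) = 0
  semisimplePart : IsSemisimplePart (jacobianAtZero f) Bs
  bracket : lieBracket f (linearField Bs) = 0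

/-- An ideal `I` of `K[[x]]` is `L_f`-invariant if `L_f(I) ⊆ I`. -/
def IsInvariant (f : VectorField n K) (I : Ideal (MvPowerSeries (Fin n) K)) : Prop :=
  ∀ φ ∈ I, lieDeriv f φ ∈ I

/-- `I` is generated by finitely many semi-invariants `φ₁, …, φₘ` of `f`, that is
`L_f(φⱼ) = νⱼ φⱼ`, with polynomial cofactors `νⱼ ∈ K[x]`. -/
def GeneratedBySemiInvariants (f : VectorField n K) (I : Ideal (MvPowerSeries (Fin n) K)) : Prop :=
  ∃ (m : ℕ) (φ : Fin m → MvPowerSeries (Fin n) K) (ν : Fin m → MvPolynomial (Fin n) K),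
    I = Ideal.span (Set.range φ) ∧
      ∀ j, lieDeriv f (φ j) = (ν j : MvPowerSeries (Fin n) K) * φ j

end FormalVF

end

/-! ### The adic filtration of `K[[x]]` and Lie derivatives. -/

noncomputable section

namespace FormalVF

open MvPowerSeries

variable {n : ℕ} {K : Type*} [Field K]

/-! Write m for `augIdeal n K`. Both `L_f` and `L_{B_s}` preserve every power of m, so they act on
the finite-dimensional algebras `K[[x]]/m^k`. There they commute, since their commutator is the Lie
derivative along the vanishing bracket. `L_{B_s}` is semisimple there, because it is so on the
coordinates and a derivation passes semisimplicity on to products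
(`isSemisimple_derivation_of_adjoin_eq_top`). Their difference is nilpotent, because it is so on
m/m² (`exists_pow_apply_mem_pow`). By uniqueness of the Jordan–Chevalley decomposition, `L_{B_s}` is
modulo m^k a polynomial in `L_f`, hence maps `I` into `I + m^k`. Krull's intersection theorem
(`mem_of_forall_mem_sup_pow`) then gives `L_{B_s}(I) ⊆ I`.

When the eigenvalues lie in `K`, `L_{B_s}` is diagonalizable modulo each m^k, and Lagrange
polynomials in it project onto the eigenspaces. The projections of an element of `I` stay in `I` and
converge adically to true eigenvectors (`exists_eigenvector_sub_mem_pow`), which lie in `I` because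
ideals are closed. These eigenvectors generate `I`, and finitely many suffice by Noetherianity. The
remaining case follows by base change along `σ`. -/

/-- The maximal ideal `⟨x₁, …, xₙ⟩` of `K[[x]]`. -/
def augIdeal (n : ℕ) (K : Type*) [Field K] : Ideal (MvPowerSeries (Fin n) K) :=
  Ideal.span (Set.range X)

lemma X_mem_augIdeal (i : Fin n) : (X i : MvPowerSeries (Fin n) K) ∈ augIdeal n K :=
  Ideal.subset_span ⟨i, rfl⟩

lemma coeff_eq_zero_of_mem_pow {k : ℕ} {φ : MvPowerSeries (Fin n) K} (h : φ ∈ augIdeal n K ^ k)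
    {d : Fin n →₀ ℕ} (hd : d.degree < k) : coeff d φ = 0 := by
  classical
  induction k generalizing φ d with
  | zero => omega
  | succ k ih =>
    rw [pow_succ] at h
    refine Submodule.mul_induction_on h (fun a ha b hb => ?_) (fun a b ha hb => ?_)
    · have hb0 : constantCoeff b = 0 := by
        refine Submodule.span_induction ?_ ?_ ?_ ?_ hb
        · rintro _ ⟨i, rfl⟩
          simp
        · simp
        · intro x y _ _ hx hy
          simp [hx, hy]
        · intro x y _ hy
          simp [hy]
      rw [coeff_mul]
      refine Finset.sum_eq_zero fun p hp => ?_
      rw [Finset.HasAntidiagonal.mem_antidiagonal] at hp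
      by_cases h2 : p.2 = 0
      · rw [h2, coeff_zero_eq_constantCoeff_apply, hb0, mul_zero]
      · have h3 : p.1.degree + p.2.degree = d.degree := by rw [← hp, map_add]
        have h4 : p.2.degree ≠ 0 := by rwa [Ne, Finsupp.degree_eq_zero_iff]
        rw [ih ha (by omega), zero_mul]
    · rw [map_add, ha, hb, add_zero]

lemma coeff_X_mul_pderiv (i : Fin n) (φ : MvPowerSeries (Fin n) K) (d : Fin n →₀ ℕ) :
    coeff d (X i * pderiv K i φ) = d i * coeff d φ := by
  classical
  by_cases h : d i = 0
  · rw [h, Nat.cast_zero, zero_mul, X, coeff_monomial_mul, if_neg]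
    intro hle
    have := hle i
    simp [h] at this
  · have hd : d - Finsupp.single i 1 + Finsupp.single i 1 = d := by
      refine tsub_add_cancel_of_le ?_
      rw [Finsupp.single_le_iff]
      omega
    have := coeff_add_monomial_mul (Finsupp.single i 1) (d - Finsupp.single i 1)
      (pderiv K i φ) (1 : K)
    rw [add_comm, hd] at this
    rw [X, this, coeff_pderiv, hd, one_mul, mul_comm]
    congr 1
    rw [Finsupp.tsub_apply, Finsupp.single_eq_same]
    rw [← Nat.cast_succ, Nat.succ_eq_add_one, Nat.sub_add_cancel (Nat.one_le_iff_ne_zero.2 h)]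

/-- Euler's identity, after dividing each coefficient by its degree, writes the series as a
combination of the variables with coefficients of order one less. -/
lemma mem_pow_of_coeff_eq_zero [CharZero K] {k : ℕ} {φ : MvPowerSeries (Fin n) K}
    (h : ∀ d : Fin n →₀ ℕ, d.degree < k → coeff d φ = 0) : φ ∈ augIdeal n K ^ k := by
  induction k generalizing φ with
  | zero => simp
  | succ k ih =>
    -- In degree 0 the inverse is the default 0, which is harmless since the constant term of `φ`
    -- vanishes.
    let ψ : MvPowerSeries (Fin n) K := fun d => (d.degree : K)⁻¹ * coeff d φ
    have hψ : ∀ d, coeff d ψ = (d.degree : K)⁻¹ * coeff d φ := fun d => rfl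
    have hsum : φ = ∑ i, X i * pderiv K i ψ := by
      ext d
      simp only [map_sum, coeff_X_mul_pderiv, hψ]
      rw [← Finset.sum_mul, ← Nat.cast_sum, ← Finsupp.degree_eq_sum]
      by_cases hd : d.degree = 0
      · rw [h d (by omega)]
        simp
      · rw [mul_inv_cancel_left₀ (by exact_mod_cast hd)]
    rw [hsum]
    refine Ideal.sum_mem _ fun i _ => ?_
    rw [pow_succ']
    refine Ideal.mul_mem_mul (X_mem_augIdeal i) (ih fun d hd => ?_)
    rw [coeff_pderiv, hψ, h _ (by rw [map_add, Finsupp.degree_single]; omega)]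
    simp

lemma mem_pow_iff [CharZero K] {k : ℕ} {φ : MvPowerSeries (Fin n) K} :
    φ ∈ augIdeal n K ^ k ↔ ∀ d : Fin n →₀ ℕ, d.degree < k → coeff d φ = 0 :=
  ⟨fun h _ hd => coeff_eq_zero_of_mem_pow h hd, mem_pow_of_coeff_eq_zero⟩

lemma mem_augIdeal_iff [CharZero K] {φ : MvPowerSeries (Fin n) K} :
    φ ∈ augIdeal n K ↔ constantCoeff φ = 0 := by
  rw [← pow_one (augIdeal n K), mem_pow_iff]
  refine ⟨fun h => h 0 (by simp), fun h d hd => ?_⟩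
  rw [Nat.lt_one_iff, Finsupp.degree_eq_zero_iff] at hd
  rw [hd, coeff_zero_eq_constantCoeff_apply, h]

lemma eq_zero_of_forall_mem_pow {φ : MvPowerSeries (Fin n) K}
    (h : ∀ k, φ ∈ augIdeal n K ^ k) : φ = 0 := by
  ext d
  exact coeff_eq_zero_of_mem_pow (h _) (Nat.lt_succ_self _)

lemma augIdeal_ne_top : augIdeal n K ≠ ⊤ := by
  intro h
  have h1 : (1 : MvPowerSeries (Fin n) K) ∈ augIdeal n K ^ 1 := by simp [h]
  have := coeff_eq_zero_of_mem_pow h1 (d := 0) (by simp)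
  simp at this

/-- Ideals of `K[[x]]` are closed in the adic topology. -/
lemma mem_of_forall_mem_sup_pow {I : Ideal (MvPowerSeries (Fin n) K)}
    {φ : MvPowerSeries (Fin n) K} (h : ∀ k, φ ∈ I ⊔ augIdeal n K ^ k) : φ ∈ I := by
  -- Krull's intersection theorem for the finite module `K[[x]]/I`.
  have key := Ideal.iInf_pow_smul_eq_bot_of_isLocalRing (I := augIdeal n K)
    (M := MvPowerSeries (Fin n) K ⧸ I) augIdeal_ne_top
  rw [← Ideal.Quotient.eq_zero_iff_mem]
  have hmem : Ideal.Quotient.mk I φ ∈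
      (⨅ k : ℕ, augIdeal n K ^ k • ⊤ :
        Submodule (MvPowerSeries (Fin n) K) (MvPowerSeries (Fin n) K ⧸ I)) := by
    rw [Submodule.mem_iInf]
    intro k
    obtain ⟨a, ha, b, hb, rfl⟩ := Submodule.mem_sup.1 (h k)
    rw [map_add, Ideal.Quotient.eq_zero_iff_mem.2 ha, zero_add]
    have : Ideal.Quotient.mk I b = b • (1 : MvPowerSeries (Fin n) K ⧸ I) := by
      change _ = Ideal.Quotient.mk I (b * 1)
      rw [mul_one]
    rw [this]
    exact Submodule.smul_mem_smul hb trivial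
  rw [key] at hmem
  exact hmem

/-- The Lie derivative `L_f` as a derivation of `K[[x]]`. -/
def lieDerivation (f : VectorField n K) :
    Derivation K (MvPowerSeries (Fin n) K) (MvPowerSeries (Fin n) K) :=
  ∑ i, f i • pderiv K i

lemma lieDerivation_apply (f : VectorField n K) (φ : MvPowerSeries (Fin n) K) :
    lieDerivation f φ = lieDeriv f φ := by
  simp only [lieDerivation, lieDeriv]
  rw [← Derivation.coeFnAddMonoidHom_apply, map_sum, Finset.sum_apply]
  rfl

lemma lieDerivation_X (f : VectorField n K) (i : Fin n) : lieDerivation f (X i) = f i := by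
  classical
  rw [lieDerivation_apply, lieDeriv, Finset.sum_eq_single i]
  · simp
  · intro j _ hj
    rw [pderiv_X_of_ne hj.symm, mul_zero]
  · simp

lemma derivation_mem_pow {D : Derivation K (MvPowerSeries (Fin n) K) (MvPowerSeries (Fin n) K)}
    (hD : ∀ φ, D φ ∈ augIdeal n K) {k : ℕ} {φ : MvPowerSeries (Fin n) K}
    (hφ : φ ∈ augIdeal n K ^ k) : D φ ∈ augIdeal n K ^ k := by
  induction k generalizing φ with
  | zero => simp
  | succ k ih =>
    rw [pow_succ] at hφ ⊢
    refine Submodule.mul_induction_on hφ (fun a ha b hb => ?_) (fun a b ha hb => ?_)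
    · rw [D.leibniz, smul_eq_mul, smul_eq_mul, mul_comm b]
      exact add_mem (Ideal.mul_mem_mul ha (hD b)) (Ideal.mul_mem_mul (ih ha) hb)
    · rw [map_add]
      exact add_mem ha hb

lemma lieDerivation_mem_augIdeal [CharZero K] {f : VectorField n K}
    (hf : ∀ i, constantCoeff (f i) = 0) (φ : MvPowerSeries (Fin n) K) :
    lieDerivation f φ ∈ augIdeal n K := by
  rw [lieDerivation_apply]
  exact Ideal.sum_mem _ fun i _ => Ideal.mul_mem_right _ _ (mem_augIdeal_iff.2 (hf i))

/-- Modulo `⟨x₁, …, xₙ⟩ᵏ`, every power series is a linear combination of monomials. -/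
lemma sub_sum_monomial_mem_pow [CharZero K] (k : ℕ) (φ : MvPowerSeries (Fin n) K) :
    φ - ∑ d ∈ (Finsupp.finite_of_degree_lt (σ := Fin n) k).toFinset,
      coeff d φ • monomial d (1 : K) ∈ augIdeal n K ^ k := by
  classical
  rw [mem_pow_iff]
  intro d hd
  rw [map_sub, map_sum, Finset.sum_eq_single d]
  · simp
  · intro e _ he
    rw [map_smul, coeff_monomial_ne he.symm, smul_zero]
  · simp [hd]

lemma monomial_mem_of_X_mem (S : Subalgebra K (MvPowerSeries (Fin n) K)) (h : ∀ i, X i ∈ S)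
    (d : Fin n →₀ ℕ) : monomial d (1 : K) ∈ S := by
  rw [monomial_one_eq]
  exact Subalgebra.prod_mem _ fun i _ => pow_mem (h i) _

lemma constantCoeff_linearField (B : Matrix (Fin n) (Fin n) K) (i : Fin n) :
    constantCoeff (linearField B i) = 0 := by
  simp [linearField]

lemma pderiv_comm (i j : Fin n) (φ : MvPowerSeries (Fin n) K) :
    pderiv K i (pderiv K j φ) = pderiv K j (pderiv K i φ) := by
  ext d
  simp only [coeff_pderiv]
  by_cases h : i = j
  · subst h; rfl
  · rw [add_right_comm]
    simp only [Finsupp.add_apply, Finsupp.single_eq_of_ne h, Finsupp.single_eq_of_ne (Ne.symm h)]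
    simp only [add_zero]
    ring

/-- The second-order terms cancel because mixed partial derivatives agree. -/
lemma lieDerivation_commutator (f g : VectorField n K) (φ : MvPowerSeries (Fin n) K) :
    lieDerivation f (lieDerivation g φ) - lieDerivation g (lieDerivation f φ) =
      lieDerivation (lieBracket f g) φ := by
  have aux : ∀ f g : VectorField n K, lieDerivation f (lieDerivation g φ) =
      ∑ i, lieDeriv f (g i) * pderiv K i φ +
        ∑ i, ∑ j, f j * g i * pderiv K j (pderiv K i φ) := by
    intro f g
    rw [lieDerivation_apply g, lieDeriv, map_sum, ← Finset.sum_add_distrib]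
    refine Finset.sum_congr rfl fun i _ => ?_
    rw [Derivation.leibniz, lieDerivation_apply, lieDerivation_apply, smul_eq_mul, smul_eq_mul,
      mul_comm (pderiv K i φ), add_comm]
    congr 1
    rw [lieDeriv, Finset.mul_sum]
    exact Finset.sum_congr rfl fun j _ => by ring
  have hswap : ∑ i, ∑ j, g j * f i * pderiv K j (pderiv K i φ) =
      ∑ i, ∑ j, f j * g i * pderiv K j (pderiv K i φ) := by
    rw [Finset.sum_comm]
    refine Finset.sum_congr rfl fun i _ => Finset.sum_congr rfl fun j _ => ?_
    rw [pderiv_comm, mul_comm (g i)]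
  rw [aux, aux, hswap, add_sub_add_right_eq_sub, ← Finset.sum_sub_distrib, lieDerivation_apply,
    lieDeriv]
  exact Finset.sum_congr rfl fun i _ => by rw [lieBracket, sub_mul]

end FormalVF

end

/-! ### Squarefree annihilating polynomials and semisimple derivations. -/

noncomputable section

namespace FormalVF

open MvPowerSeries Polynomial

section General

variable {K : Type*} [Field K]

lemma map_aeval_of_intertwines {M N : Type*} [AddCommGroup M] [Module K M] [AddCommGroup N]
    [Module K N] (h : M →ₗ[K] N) {E : Module.End K M} {F : Module.End K N}
    (hEF : ∀ x, h (E x) = F (h x)) (p : K[X]) (x : M) :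
    h (aeval E p x) = aeval F p (h x) := by
  induction p using Polynomial.induction_on' with
  | add p q hp hq => simp [hp, hq]
  | monomial k a =>
    have hpow : ∀ y, h ((E ^ k) y) = (F ^ k) (h y) := by
      induction k with
      | zero => simp
      | succ k ih => intro y; rw [pow_succ, pow_succ, Module.End.mul_apply, ih, hEF,
          Module.End.mul_apply]
    simp [aeval_monomial, hpow, Module.algebraMap_end_apply]

lemma exists_squarefree_dvd_dvd {p q : K[X]} (hp : Squarefree p) (hq : Squarefree q) :
    ∃ r : K[X], Squarefree r ∧ p ∣ r ∧ q ∣ r := by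
  classical
  have hpq : p * q ≠ 0 := mul_ne_zero hp.ne_zero hq.ne_zero
  refine ⟨UniqueFactorizationMonoid.radical (p * q),
    UniqueFactorizationMonoid.squarefree_radical, ?_, ?_⟩
  · rw [UniqueFactorizationMonoid.dvd_radical_iff hp.isRadical hpq]
    exact dvd_mul_right _ _
  · rw [UniqueFactorizationMonoid.dvd_radical_iff hq.isRadical hpq]
    exact dvd_mul_left _ _

lemma aeval_apply_eq_zero_of_dvd {M : Type*} [AddCommGroup M] [Module K M] {E : Module.End K M}
    {p r : K[X]} {x : M} (h : p ∣ r) (hx : aeval E p x = 0) : aeval E r x = 0 := by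
  obtain ⟨s, rfl⟩ := h
  rw [mul_comm, map_mul, Module.End.mul_apply, hx, map_zero]

/-- `T` plays the role of `U ⊗ W`, with `S₁ = DU ⊗ 1` and `S₂ = 1 ⊗ DW`. These are commuting
semisimple maps, and over a perfect field their sum is again semisimple. -/
lemma exists_squarefree_aeval_add_eq_zero [PerfectField K] {U W T : Type*} [AddCommGroup U]
    [Module K U] [AddCommGroup W] [Module K W] [AddCommGroup T] [Module K T] [FiniteDimensional K T]
    (τ : U →ₗ[K] W →ₗ[K] T) (hτ : ∀ F G : Module.End K T, (∀ u w, F (τ u w) = G (τ u w)) → F = G)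
    {DU : Module.End K U} {DW : Module.End K W} {S₁ S₂ : Module.End K T}
    (h₁ : ∀ u w, τ (DU u) w = S₁ (τ u w)) (h₂ : ∀ u w, τ u (DW w) = S₂ (τ u w)) {p q : K[X]}
    (hp : Squarefree p) (hq : Squarefree q) (hU : aeval DU p = 0) (hW : aeval DW q = 0) :
    ∃ r : K[X], Squarefree r ∧ aeval (S₁ + S₂) r = 0 := by
  have hS₁ : S₁.IsSemisimple := by
    refine Module.End.isSemisimple_of_squarefree_aeval_eq_zero hp (hτ _ _ fun u w => ?_)
    have := map_aeval_of_intertwines (τ.flip w) (F := S₁) (fun u => h₁ u w) p u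
    rw [hU] at this
    simpa using this.symm
  have hS₂ : S₂.IsSemisimple := by
    refine Module.End.isSemisimple_of_squarefree_aeval_eq_zero hq (hτ _ _ fun u w => ?_)
    have := map_aeval_of_intertwines (τ u) (F := S₂) (fun w => h₂ u w) q w
    rw [hW] at this
    simpa using this.symm
  have hcomm : Commute S₁ S₂ := hτ _ _ fun u w => by
    simp only [Module.End.mul_apply, ← h₁, ← h₂]
  exact ⟨minpoly K (S₁ + S₂), (hS₁.add_of_commute hcomm hS₂).minpoly_squarefree,
    minpoly.aeval _ _⟩

/-- Trades a vector killed by `p` for an endomorphism killed by `p`, on an invariant subspace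
containing the vector. -/
lemma aeval_restrict_ker_eq_zero {M : Type*} [AddCommGroup M] [Module K M] (E : Module.End K M)
    (p : K[X]) : ∃ F : Module.End K (LinearMap.ker (aeval E p)),
      (∀ x, (F x : M) = E x) ∧ aeval F p = 0 := by
  have hinv : ∀ x ∈ LinearMap.ker (aeval E p), E x ∈ LinearMap.ker (aeval E p) := by
    intro x hx
    rw [LinearMap.mem_ker] at hx ⊢
    rw [← map_aeval_of_intertwines E (fun _ => rfl) p x, hx, map_zero]
  refine ⟨E.restrict hinv, fun _ => rfl, ?_⟩
  ext x
  have := map_aeval_of_intertwines (LinearMap.ker (aeval E p)).subtype (E := E.restrict hinv)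
    (F := E) (fun _ => rfl) p x
  rw [Submodule.subtype_apply] at this
  rw [this]
  exact x.2

/-- The Leibniz rule `hβ` says that the linear map `U ⊗ W → A` induced by `β` intertwines `DU ⊗ 1 +
1 ⊗ DW` with `E`. -/
lemma exists_squarefree_aeval_bilin_eq_zero [PerfectField K] {U W A : Type*} [AddCommGroup U]
    [Module K U] [AddCommGroup W] [Module K W] [AddCommGroup A] [Module K A]
    [FiniteDimensional K U] [FiniteDimensional K W] (β : U →ₗ[K] W →ₗ[K] A)
    {DU : Module.End K U} {DW : Module.End K W} {E : Module.End K A}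
    (hβ : ∀ u w, E (β u w) = β (DU u) w + β u (DW w)) {p q : K[X]}
    (hp : Squarefree p) (hq : Squarefree q) (hU : aeval DU p = 0) (hW : aeval DW q = 0) :
    ∃ r : K[X], Squarefree r ∧ ∀ u w, aeval E r (β u w) = 0 := by
  obtain ⟨r, hr, hr0⟩ := exists_squarefree_aeval_add_eq_zero (T := TensorProduct K U W)
    (TensorProduct.mk K U W) (fun _ _ h => TensorProduct.ext' h)
    (DU := DU) (DW := DW) (S₁ := LinearMap.rTensor W DU) (S₂ := LinearMap.lTensor U DW)
    (fun _ _ => rfl) (fun _ _ => rfl) hp hq hU hW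
  refine ⟨r, hr, fun u w => ?_⟩
  have hμ : TensorProduct.lift β ∘ₗ (LinearMap.rTensor W DU + LinearMap.lTensor U DW) =
      E ∘ₗ TensorProduct.lift β :=
    TensorProduct.ext' fun u w => (hβ u w).symm
  have := map_aeval_of_intertwines (TensorProduct.lift β) (fun t => LinearMap.congr_fun hμ t) r
    (TensorProduct.tmul K u w)
  rw [hr0, LinearMap.zero_apply, map_zero] at this
  exact this.symm

/-- Over a perfect field, products of vectors killed by squarefree polynomials in a derivation
are killed by squarefree polynomials in the derivation. -/
lemma exists_squarefree_aeval_mul_eq_zero [PerfectField K] {A : Type*} [CommRing A] [Algebra K A]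
    [FiniteDimensional K A] (D : Derivation K A A) {a b : A} {p q : K[X]}
    (hp : Squarefree p) (hq : Squarefree q)
    (ha : aeval (D : Module.End K A) p a = 0) (hb : aeval (D : Module.End K A) q b = 0) :
    ∃ r : K[X], Squarefree r ∧ aeval (D : Module.End K A) r (a * b) = 0 := by
  obtain ⟨DU, hDU, hU⟩ := aeval_restrict_ker_eq_zero (D : Module.End K A) p
  obtain ⟨DW, hDW, hW⟩ := aeval_restrict_ker_eq_zero (D : Module.End K A) q
  have hβ : ∀ (u : LinearMap.ker (aeval (D : Module.End K A) p))
      (w : LinearMap.ker (aeval (D : Module.End K A) q)),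
      D ((u : A) * (w : A)) = (DU u : A) * w + u * (DW w : A) := fun u w => by
    rw [hDU, hDW, D.leibniz, smul_eq_mul, smul_eq_mul, add_comm, mul_comm (w : A)]
    rfl
  obtain ⟨r, hr, hr0⟩ := exists_squarefree_aeval_bilin_eq_zero ((LinearMap.mul K A).compl₁₂
    (LinearMap.ker (aeval (D : Module.End K A) p)).subtype
    (LinearMap.ker (aeval (D : Module.End K A) q)).subtype) (DU := DU) (DW := DW)
    (E := (D : Module.End K A)) hβ hp hq hU hW
  exact ⟨r, hr, hr0 ⟨a, ha⟩ ⟨b, hb⟩⟩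

/-- The vectors killed by some squarefree polynomial in `D` form a subalgebra. A finite spanning set
then has one common squarefree annihilator. -/
lemma isSemisimple_derivation_of_adjoin_eq_top [PerfectField K] {A : Type*} [CommRing A]
    [Algebra K A] [FiniteDimensional K A] (D : Derivation K A A) {s : Set A}
    (hs : Algebra.adjoin K s = ⊤)
    (h : ∀ a ∈ s, ∃ p : K[X], Squarefree p ∧ aeval (D : Module.End K A) p a = 0) :
    Module.End.IsSemisimple (D : Module.End K A) := by
  have hall : ∀ a : A, ∃ p : K[X], Squarefree p ∧ aeval (D : Module.End K A) p a = 0 := by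
    intro a
    have ha : a ∈ Algebra.adjoin K s := hs ▸ trivial
    induction ha using Algebra.adjoin_induction with
    | mem x hx => exact h x hx
    -- A derivation kills scalars, so the polynomial `X` annihilates them.
    | algebraMap r => exact ⟨X, Polynomial.irreducible_X.squarefree, by simp⟩
    | add x y _ _ hx hy =>
      obtain ⟨p, hp, hpx⟩ := hx
      obtain ⟨q, hq, hqy⟩ := hy
      obtain ⟨r, hr, hpr, hqr⟩ := exists_squarefree_dvd_dvd hp hq
      refine ⟨r, hr, ?_⟩
      rw [map_add, aeval_apply_eq_zero_of_dvd hpr hpx, aeval_apply_eq_zero_of_dvd hqr hqy,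
        add_zero]
    | mul x y _ _ hx hy =>
      obtain ⟨p, hp, hpx⟩ := hx
      obtain ⟨q, hq, hqy⟩ := hy
      exact exists_squarefree_aeval_mul_eq_zero D hp hq hpx hqy
  classical
  have hfin : ∀ t : Finset A, ∃ p : K[X], Squarefree p ∧
      ∀ a ∈ t, aeval (D : Module.End K A) p a = 0 := by
    intro t
    induction t using Finset.induction_on with
    | empty => exact ⟨1, squarefree_one, by simp⟩
    | insert a t _ ih =>
      obtain ⟨p, hp, hpt⟩ := ih
      obtain ⟨q, hq, hqa⟩ := hall a
      obtain ⟨r, hr, hpr, hqr⟩ := exists_squarefree_dvd_dvd hp hq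
      refine ⟨r, hr, fun b hb => ?_⟩
      rcases Finset.mem_insert.1 hb with rfl | hb
      · exact aeval_apply_eq_zero_of_dvd hqr hqa
      · exact aeval_apply_eq_zero_of_dvd hpr (hpt b hb)
  obtain ⟨t, ht⟩ := Module.Finite.fg_top (R := K) (M := A)
  obtain ⟨p, hp, hpt⟩ := hfin t
  refine Module.End.isSemisimple_of_squarefree_aeval_eq_zero hp ?_
  exact LinearMap.ext_on ht fun a ha => hpt a ha

end General

/-! ### The action on linear forms. -/

variable {n : ℕ} {K : Type*} [Field K]

/-- The linear form `∑ cᵢ xᵢ`. -/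
def linForm (n : ℕ) (K : Type*) [Field K] : (Fin n → K) →ₗ[K] MvPowerSeries (Fin n) K :=
  Fintype.linearCombination K X

lemma linForm_apply (c : Fin n → K) : linForm n K c = ∑ i, c i • X i := rfl

lemma linearField_eq_linForm (B : Matrix (Fin n) (Fin n) K) (i : Fin n) :
    linearField B i = linForm n K (B i) := by
  simp only [linearField, linForm_apply, MvPowerSeries.smul_eq_C_mul]

/-- The transpose appears because `B` acts on points while `c` is a covector. -/
lemma lieDerivation_linForm (B : Matrix (Fin n) (Fin n) K) (c : Fin n → K) :
    lieDerivation (linearField B) (linForm n K c) =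
      linForm n K (Matrix.toLin' B.transpose c) := by
  rw [linForm_apply, map_sum]
  simp only [Derivation.map_smul, lieDerivation_X, linearField_eq_linForm]
  simp only [← map_smul, ← map_sum]
  congr 1
  ext j
  simp [Matrix.mulVec, dotProduct, mul_comm]

lemma sub_linForm_mem [CharZero K] {φ : MvPowerSeries (Fin n) K} (h : constantCoeff φ = 0) :
    φ - linForm n K (fun j => constantCoeff (pderiv K j φ)) ∈ augIdeal n K ^ 2 := by
  classical
  rw [mem_pow_iff]
  intro d hd
  have hc : ∀ j, constantCoeff (pderiv K j φ) = coeff (Finsupp.single j 1) φ := by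
    intro j
    rw [← coeff_zero_eq_constantCoeff_apply, coeff_pderiv]
    simp
  rw [map_sub, linForm_apply, map_sum]
  simp only [map_smul, hc]
  by_cases hd0 : d.degree = 0
  · rw [Finsupp.degree_eq_zero_iff] at hd0
    subst hd0
    simp [h]
  · obtain ⟨j, rfl⟩ : ∃ j, d = Finsupp.single j 1 := by
      obtain ⟨j, hj⟩ := Finsupp.ne_iff.1 (mt (Finsupp.degree_eq_zero_iff d).2 hd0)
      have hle : Finsupp.single j 1 ≤ d := Finsupp.single_le_iff.2 (Nat.one_le_iff_ne_zero.2 hj)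
      have hdec := tsub_add_cancel_of_le hle
      have hdeg := congrArg Finsupp.degree hdec
      rw [map_add, Finsupp.degree_single] at hdeg
      have hz := (Finsupp.degree_eq_zero_iff (d - Finsupp.single j 1)).1 (by omega)
      rw [hz, zero_add] at hdec
      exact ⟨j, hdec.symm⟩
    rw [Finset.sum_eq_single j]
    · simp
    · intro i _ hi
      rw [MvPowerSeries.coeff_X, if_neg, smul_zero]
      intro he
      exact hi (Finsupp.single_left_injective one_ne_zero he).symm
    · simp

end FormalVF

end

/-! ### Nilpotency modulo powers of the maximal ideal. -/

noncomputable section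

namespace FormalVF

open MvPowerSeries Polynomial

variable {n : ℕ} {K : Type*} [Field K]

/-- In the Leibniz expansion of `D^(u+v)(ab)`, each term differentiates `a` at least `u` times or
`b` at least `v` times. The induction on `u + v` replaces the binomial formula. -/
lemma pow_add_apply_mul_mem
    {D : Derivation K (MvPowerSeries (Fin n) K) (MvPowerSeries (Fin n) K)}
    (hD : ∀ φ, D φ ∈ augIdeal n K) {i j u v : ℕ} {a b : MvPowerSeries (Fin n) K}
    (ha : a ∈ augIdeal n K ^ i) (hb : b ∈ augIdeal n K ^ j)
    (hDa : ((D : Module.End K (MvPowerSeries (Fin n) K)) ^ u) a ∈ augIdeal n K ^ (i + 1))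
    (hDb : ((D : Module.End K (MvPowerSeries (Fin n) K)) ^ v) b ∈ augIdeal n K ^ (j + 1)) :
    ((D : Module.End K (MvPowerSeries (Fin n) K)) ^ (u + v)) (a * b) ∈
      augIdeal n K ^ (i + j + 1) := by
  have hpow : ∀ w k φ, φ ∈ augIdeal n K ^ k →
      ((D : Module.End K (MvPowerSeries (Fin n) K)) ^ w) φ ∈ augIdeal n K ^ k := by
    intro w
    induction w with
    | zero => intro k φ h; exact h
    | succ w ih =>
      intro k φ h
      rw [pow_succ (M := Module.End K (MvPowerSeries (Fin n) K)), Module.End.mul_apply]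
      exact ih k _ (derivation_mem_pow hD h)
  induction hN : u + v generalizing u v a b with
  | zero =>
    obtain ⟨rfl, rfl⟩ : u = 0 ∧ v = 0 := by omega
    rw [add_right_comm, pow_add]
    exact Ideal.mul_mem_mul hDa hb
  | succ N ih =>
    rcases Nat.eq_zero_or_pos u with rfl | hu
    · refine hpow _ _ _ ?_
      rw [add_right_comm, pow_add]
      exact Ideal.mul_mem_mul hDa hb
    rcases Nat.eq_zero_or_pos v with rfl | hv
    · refine hpow _ _ _ ?_
      rw [add_assoc, pow_add]
      exact Ideal.mul_mem_mul ha hDb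
    obtain ⟨u, rfl⟩ := Nat.exists_eq_add_of_le' hu
    obtain ⟨v, rfl⟩ := Nat.exists_eq_add_of_le' hv
    rw [pow_succ (M := Module.End K (MvPowerSeries (Fin n) K)), Module.End.mul_apply]
    change ((D : Module.End K (MvPowerSeries (Fin n) K)) ^ N) (D (a * b)) ∈ _
    rw [D.leibniz, smul_eq_mul, smul_eq_mul, mul_comm b, map_add]
    refine add_mem (ih (u := u + 1) (v := v) ha (derivation_mem_pow hD hb) hDa ?_ (by omega))
      (ih (u := u) (v := v + 1) (derivation_mem_pow hD ha) hb ?_ hDb (by omega))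
    · rwa [pow_succ (M := Module.End K (MvPowerSeries (Fin n) K)), Module.End.mul_apply] at hDb
    · rwa [pow_succ (M := Module.End K (MvPowerSeries (Fin n) K)), Module.End.mul_apply] at hDa

/-- A derivation of `K[[x]]` that is nilpotent on the cotangent space is nilpotent modulo each
power of the maximal ideal. -/
lemma exists_pow_apply_mem_pow
    {D : Derivation K (MvPowerSeries (Fin n) K) (MvPowerSeries (Fin n) K)}
    (hD : ∀ φ, D φ ∈ augIdeal n K)
    (hnil : ∃ r, ∀ φ ∈ augIdeal n K,
      ((D : Module.End K (MvPowerSeries (Fin n) K)) ^ r) φ ∈ augIdeal n K ^ 2) (k : ℕ) :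
    ∃ r, ∀ φ, ((D : Module.End K (MvPowerSeries (Fin n) K)) ^ r) φ ∈ augIdeal n K ^ k := by
  obtain ⟨s, hs⟩ := hnil
  -- Nilpotency on each graded piece m^j/m^(j+1). Composing these for all `j < k` gives the claim.
  have hstep : ∀ j, ∃ r, ∀ φ ∈ augIdeal n K ^ j,
      ((D : Module.End K (MvPowerSeries (Fin n) K)) ^ r) φ ∈ augIdeal n K ^ (j + 1) := by
    intro j
    induction j with
    | zero => exact ⟨1, fun φ _ => by simpa using hD φ⟩
    | succ j ih =>
      obtain ⟨r, hr⟩ := ih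
      refine ⟨r + s, fun φ hφ => ?_⟩
      rw [pow_succ] at hφ
      refine Submodule.mul_induction_on hφ (fun a ha b hb => ?_) (fun a b ha hb => ?_)
      · exact pow_add_apply_mul_mem hD ha (by rwa [pow_one]) (hr a ha) (hs b hb)
      · rw [map_add]
        exact add_mem ha hb
  induction k with
  | zero => exact ⟨0, fun φ => by simp⟩
  | succ k ih =>
    obtain ⟨r, hr⟩ := ih
    obtain ⟨t, ht⟩ := hstep k
    refine ⟨t + r, fun φ => ?_⟩
    rw [pow_add (M := Module.End K (MvPowerSeries (Fin n) K)), Module.End.mul_apply]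
    exact ht _ (hr φ)

lemma lieDerivation_sub (f g : VectorField n K) :
    lieDerivation (f - g) = lieDerivation f - lieDerivation g := by
  simp only [lieDerivation, Pi.sub_apply, ← Finset.sum_sub_distrib]
  exact Finset.sum_congr rfl fun i _ => Derivation.ext fun φ => sub_mul _ _ _

/-- If the linear part of `g` is nilpotent then `L_g` is nilpotent on the cotangent space. -/
lemma lieDerivation_nilpotent_cotangent [CharZero K] {g : VectorField n K}
    (hg : ∀ i, constantCoeff (g i) = 0) (hnil : IsNilpotent (jacobianAtZero g)) :
    ∃ r, ∀ φ ∈ augIdeal n K,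
      ((lieDerivation g : Module.End K (MvPowerSeries (Fin n) K)) ^ r) φ ∈ augIdeal n K ^ 2 := by
  have hD := lieDerivation_mem_augIdeal hg
  -- Modulo m², `L_g` acts on linear forms through the transposed Jacobian.
  have hlin : ∀ c : Fin n → K, lieDerivation g (linForm n K c) -
      linForm n K ((jacobianAtZero g).transpose.mulVec c) ∈ augIdeal n K ^ 2 := by
    intro c
    have h1 : linForm n K ((jacobianAtZero g).transpose.mulVec c) =
        ∑ i, c i • linForm n K (jacobianAtZero g i) := by
      simp only [← map_smul, ← map_sum]
      congr 1
      ext j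
      simp [Matrix.mulVec, dotProduct, mul_comm]
    rw [h1, linForm_apply, map_sum]
    simp only [Derivation.map_smul, lieDerivation_X]
    rw [← Finset.sum_sub_distrib]
    refine Submodule.sum_mem _ fun i _ => ?_
    rw [← smul_sub, MvPowerSeries.smul_eq_C_mul]
    exact Ideal.mul_mem_left _ _ (sub_linForm_mem (hg i))
  have hiter : ∀ r (c : Fin n → K),
      ((lieDerivation g : Module.End K (MvPowerSeries (Fin n) K)) ^ r) (linForm n K c) -
        linForm n K (((jacobianAtZero g).transpose ^ r).mulVec c) ∈ augIdeal n K ^ 2 := by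
    intro r
    induction r with
    | zero => intro c; simp
    | succ r ih =>
      intro c
      have h2 := add_mem (derivation_mem_pow hD (ih c))
        (hlin (((jacobianAtZero g).transpose ^ r).mulVec c))
      rw [map_sub, sub_add_sub_cancel, Matrix.mulVec_mulVec, ← pow_succ'] at h2
      rw [pow_succ' (M := Module.End K (MvPowerSeries (Fin n) K)), Module.End.mul_apply]
      exact h2
  obtain ⟨r, hr⟩ := hnil
  refine ⟨r, fun φ hφ => ?_⟩
  have h3 : ∀ w φ, φ ∈ augIdeal n K ^ 2 →
      ((lieDerivation g : Module.End K (MvPowerSeries (Fin n) K)) ^ w) φ ∈ augIdeal n K ^ 2 := by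
    intro w
    induction w with
    | zero => intro φ h; exact h
    | succ w ih =>
      intro φ h
      rw [pow_succ (M := Module.End K (MvPowerSeries (Fin n) K)), Module.End.mul_apply]
      exact ih _ (derivation_mem_pow hD h)
  have h4 := h3 r _ (sub_linForm_mem (mem_augIdeal_iff.1 hφ))
  have h5 := hiter r (fun j => constantCoeff (pderiv K j φ))
  rw [← Matrix.transpose_pow, hr, Matrix.transpose_zero, Matrix.zero_mulVec, map_zero,
    sub_zero] at h5
  rw [map_sub] at h4
  simpa using add_mem h4 h5

lemma jacobianAtZero_sub_linearField (f : VectorField n K) (B : Matrix (Fin n) (Fin n) K) :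
    jacobianAtZero (f - linearField B) = jacobianAtZero f - B := by
  classical
  ext i j
  simp only [jacobianAtZero, Matrix.of_apply, Matrix.sub_apply, Pi.sub_apply, map_sub]
  congr 1
  rw [linearField_eq_linForm, linForm_apply, map_sum, map_sum, Finset.sum_eq_single j]
  · simp [MvPowerSeries.smul_eq_C_mul]
  · intro k _ hk
    rw [Derivation.map_smul, pderiv_X_of_ne hk, smul_zero, map_zero]
  · simp

lemma aeval_transpose_eq_zero {B : Matrix (Fin n) (Fin n) K} {q : K[X]} (hq : aeval B q = 0) :
    aeval (Matrix.toLin' B.transpose) q = 0 := by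
  have h1 : aeval B.transpose q = 0 := by
    suffices aeval B.transpose q = (aeval B q).transpose by rw [this, hq, Matrix.transpose_zero]
    clear hq
    induction q using Polynomial.induction_on' with
    | add p q hp hq => simp [hp, hq]
    | monomial k a => simp [aeval_monomial, Algebra.algebraMap_eq_smul_one]
  have := Polynomial.aeval_algHom_apply (Matrix.toLinAlgEquiv' (R := K) (n := Fin n)) B.transpose q
  rw [h1, map_zero] at this
  exact this

lemma aeval_lieDerivation_X {B : Matrix (Fin n) (Fin n) K} {q : K[X]} (hq : aeval B q = 0)
    (i : Fin n) : aeval (lieDerivation (linearField B) :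
      Module.End K (MvPowerSeries (Fin n) K)) q (MvPowerSeries.X i) = 0 := by
  classical
  have := map_aeval_of_intertwines (linForm n K)
    (F := (lieDerivation (linearField B) : Module.End K (MvPowerSeries (Fin n) K)))
    (fun c => (lieDerivation_linForm B c).symm) q (Pi.single i 1)
  rw [aeval_transpose_eq_zero hq, LinearMap.zero_apply, map_zero] at this
  rw [this]
  congr 1
  rw [linForm, Fintype.linearCombination_apply_single, one_smul]

lemma span_monomial_quotient [CharZero K] (k : ℕ) :
    Submodule.span K ((fun d => Ideal.Quotient.mkₐ K (augIdeal n K ^ k) (monomial d (1 : K))) ''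
      {d : Fin n →₀ ℕ | d.degree < k}) = ⊤ := by
  rw [eq_top_iff]
  rintro x -
  obtain ⟨φ, rfl⟩ := Ideal.Quotient.mkₐ_surjective K _ x
  have h := Ideal.Quotient.eq_zero_iff_mem.2 (sub_sum_monomial_mem_pow k φ)
  rw [← Ideal.Quotient.mkₐ_eq_mk K, map_sub, sub_eq_zero] at h
  rw [h, map_sum]
  refine Submodule.sum_mem _ fun d hd => ?_
  rw [map_smul]
  exact Submodule.smul_mem _ _ (Submodule.subset_span ⟨d, by simpa using hd, rfl⟩)

lemma aeval_apply_mem_ideal {E : Module.End K (MvPowerSeries (Fin n) K)}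
    {I : Ideal (MvPowerSeries (Fin n) K)} (hE : ∀ φ ∈ I, E φ ∈ I) (p : K[X])
    {φ : MvPowerSeries (Fin n) K} (hφ : φ ∈ I) : aeval E p φ ∈ I := by
  induction p using Polynomial.induction_on' with
  | add p q hp hq =>
    rw [map_add, LinearMap.add_apply]
    exact add_mem hp hq
  | monomial j a =>
    have hpow : (E ^ j) φ ∈ I := by
      induction j with
      | zero => exact hφ
      | succ j ih =>
        rw [pow_succ', Module.End.mul_apply]
        exact hE _ ih
    rw [aeval_monomial, Module.End.mul_apply, Module.algebraMap_end_apply,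
      MvPowerSeries.smul_eq_C_mul]
    exact Ideal.mul_mem_left _ _ hpow

lemma IsInvariant.aeval_mem {f : VectorField n K} {I : Ideal (MvPowerSeries (Fin n) K)}
    (hI : IsInvariant f I) (p : K[X]) {φ : MvPowerSeries (Fin n) K} (hφ : φ ∈ I) :
    aeval (lieDerivation f : Module.End K (MvPowerSeries (Fin n) K)) p φ ∈ I :=
  aeval_apply_mem_ideal (fun ψ hψ => by
    have := hI ψ hψ
    rwa [← lieDerivation_apply] at this) p hφ

/-! ### Invariance under the semisimple part. -/

/-- An `L_f`-invariant ideal is invariant under `L_{B_s}`, for `f` in normal form. -/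
theorem IsPDNF.isInvariant_linearField [CharZero K] {f : VectorField n K}
    {Bs : Matrix (Fin n) (Fin n) K} (hf : IsPDNF f Bs) {I : Ideal (MvPowerSeries (Fin n) K)}
    (hI : IsInvariant f I) : IsInvariant (linearField Bs) I := by
  intro φ hφ
  refine mem_of_forall_mem_sup_pow fun k => ?_
  rw [← lieDerivation_apply]
  have hDf := lieDerivation_mem_augIdeal hf.stationary
  have hDB := lieDerivation_mem_augIdeal (constantCoeff_linearField Bs)
  have hg : ∀ i, constantCoeff ((f - linearField Bs) i) = 0 := fun i => by
    rw [Pi.sub_apply, map_sub, hf.stationary, constantCoeff_linearField, sub_zero]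
  let π := Ideal.Quotient.mkₐ K (augIdeal n K ^ k)
  have hπ : Function.Surjective π := Ideal.Quotient.mkₐ_surjective K _
  have hker : ∀ ψ, π ψ = 0 ↔ ψ ∈ augIdeal n K ^ k := fun ψ => Ideal.Quotient.eq_zero_iff_mem
  have hfd : FiniteDimensional K (MvPowerSeries (Fin n) K ⧸ augIdeal n K ^ k) :=
    ⟨(span_monomial_quotient (n := n) (K := K) k) ▸ Submodule.fg_span
      ((Finsupp.finite_of_degree_lt k).image _)⟩
  let Ef := (lieDerivation f).liftOfSurjective hπ
    fun ψ h => (hker _).2 (derivation_mem_pow hDf ((hker _).1 h))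
  let EB := (lieDerivation (linearField Bs)).liftOfSurjective hπ
    fun ψ h => (hker _).2 (derivation_mem_pow hDB ((hker _).1 h))
  have hEf : ∀ ψ, Ef (π ψ) = π (lieDerivation f ψ) := fun ψ =>
    Derivation.liftOfSurjective_apply hπ _ ψ
  have hEB : ∀ ψ, EB (π ψ) = π (lieDerivation (linearField Bs) ψ) := fun ψ =>
    Derivation.liftOfSurjective_apply hπ _ ψ
  let E₁ : Module.End K (MvPowerSeries (Fin n) K ⧸ augIdeal n K ^ k) := Ef
  let E₂ : Module.End K (MvPowerSeries (Fin n) K ⧸ augIdeal n K ^ k) := EB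
  have hcomm : Commute E₁ E₂ := by
    refine LinearMap.ext fun x => ?_
    obtain ⟨ψ, rfl⟩ := hπ x
    change Ef (EB (π ψ)) = EB (Ef (π ψ))
    rw [hEB, hEf, hEf, hEB, ← sub_eq_zero, ← map_sub, lieDerivation_commutator, hf.bracket]
    simp [lieDerivation]
  -- The classes of the coordinates generate the quotient algebra, and each is killed by the
  -- squarefree minimal polynomial of `Bs`.
  have hss : E₂.IsSemisimple := by
    refine isSemisimple_derivation_of_adjoin_eq_top EB
      (s := Set.range fun i => π (MvPowerSeries.X i)) ?_ ?_
    · rw [eq_top_iff]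
      intro x _
      have hx := Submodule.mem_top (R := K) (x := x)
      rw [← span_monomial_quotient k] at hx
      refine (Submodule.span_le (p := Subalgebra.toSubmodule
        (Algebra.adjoin K (Set.range fun i => π (MvPowerSeries.X i))))).2 ?_ hx
      rintro _ ⟨d, -, rfl⟩
      exact monomial_mem_of_X_mem ((Algebra.adjoin K _).comap π)
        (fun i => (Algebra.subset_adjoin (Set.mem_range_self i) :
          π (MvPowerSeries.X i) ∈ Algebra.adjoin K (Set.range fun i => π (MvPowerSeries.X i)))) d
    · rintro _ ⟨i, rfl⟩
      have hsq := hf.semisimplePart.semisimple.minpoly_squarefree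
      rw [Matrix.minpoly_toLin'] at hsq
      refine ⟨minpoly K Bs, hsq, ?_⟩
      have := map_aeval_of_intertwines π.toLinearMap (E := (lieDerivation (linearField Bs) :
        Module.End K (MvPowerSeries (Fin n) K))) (F := E₂) (fun ψ => (hEB ψ).symm)
        (minpoly K Bs) (MvPowerSeries.X i)
      rw [aeval_lieDerivation_X (minpoly.aeval K Bs), map_zero] at this
      exact this.symm
  have hnil : IsNilpotent (E₁ - E₂) := by
    obtain ⟨r, hr⟩ := exists_pow_apply_mem_pow (lieDerivation_mem_augIdeal hg)
      (lieDerivation_nilpotent_cotangent hg (by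
        rw [jacobianAtZero_sub_linearField]
        exact hf.semisimplePart.nilpotent)) k
    refine ⟨r, LinearMap.ext fun x => ?_⟩
    obtain ⟨ψ, rfl⟩ := hπ x
    have := map_aeval_of_intertwines π.toLinearMap
      (E := (lieDerivation (f - linearField Bs) : Module.End K (MvPowerSeries (Fin n) K)))
      (F := E₁ - E₂) (fun ψ => by
        change π (lieDerivation (f - linearField Bs) ψ) = Ef (π ψ) - EB (π ψ)
        rw [hEf, hEB, ← map_sub, lieDerivation_sub]
        rfl) (Polynomial.X ^ r) ψ
    rw [map_pow, aeval_X, map_pow, aeval_X] at this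
    exact this.symm.trans ((hker _).2 (hr ψ))
  -- The semisimple part `S` is a polynomial in `E₁`, and uniqueness identifies it with `E₂`. The
  -- polynomial depends on `k`.
  obtain ⟨N, hN, S, hS, hNnil, hSss, hNS⟩ := E₁.exists_isNilpotent_isSemisimple
  have hcNS : Commute N S := Algebra.commute_of_mem_adjoin_singleton_of_commute hS
    (Algebra.commute_of_mem_adjoin_singleton_of_commute hN (Commute.refl E₁)).symm
  have hSE : S = E₂ := (Module.End.isNilpotent_isSemisimple_unique hNnil hSss hnil hss hcNS
    (hcomm.sub_left (Commute.refl E₂)) (by rw [← hNS, sub_add_cancel])).2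
  rw [Algebra.adjoin_singleton_eq_range_aeval] at hS
  obtain ⟨p, hp⟩ := hS
  have := map_aeval_of_intertwines π.toLinearMap (E := (lieDerivation f :
    Module.End K (MvPowerSeries (Fin n) K))) (F := E₁) (fun ψ => (hEf ψ).symm) p φ
  have hp' : aeval E₁ p = E₂ := hp.trans hSE
  rw [hp'] at this
  have h6 : lieDerivation (linearField Bs) φ -
      aeval (lieDerivation f : Module.End K (MvPowerSeries (Fin n) K)) p φ ∈ augIdeal n K ^ k := by
    rw [← hker, map_sub, sub_eq_zero, ← hEB]
    exact this.symm
  rw [← add_sub_cancel (aeval (lieDerivation f : Module.End K (MvPowerSeries (Fin n) K)) p φ)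
    (lieDerivation (linearField Bs) φ)]
  exact add_mem (Ideal.mem_sup_left (hI.aeval_mem p hφ)) (Ideal.mem_sup_right h6)

end FormalVF

end

/-! ### Lagrange projections and generation by eigenvectors. -/

noncomputable section

namespace FormalVF

open Polynomial

section General

variable {K : Type*} [Field K]

/-- This and the next two lemmas make Lagrange polynomials act as spectral projections: on the nodes
they sum to 1, are killed by `X - μ`, and are unchanged when the node set grows. -/
lemma eval_sum_lagrangeBasis_sub_one [DecidableEq K] (S : Finset K) {ν : K} (hν : ν ∈ S) :
    (∑ μ ∈ S, Lagrange.basis S id μ - 1).eval ν = 0 := by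
  rw [Lagrange.sum_basis Function.injective_id.injOn ⟨ν, hν⟩]
  simp

lemma eval_X_sub_C_mul_lagrangeBasis [DecidableEq K] (S : Finset K) (μ : K) {ν : K} (hν : ν ∈ S) :
    ((X - C μ) * Lagrange.basis S id μ).eval ν = 0 := by
  rw [eval_mul]
  rcases eq_or_ne μ ν with rfl | h
  · simp
  · have := Lagrange.eval_basis_of_ne (v := id) h hν
    rw [id_eq] at this
    rw [this, mul_zero]

lemma eval_lagrangeBasis_sub [DecidableEq K] {S T : Finset K} (hST : S ⊆ T) {μ ν : K}
    (hμ : μ ∈ S) (hν : ν ∈ S) :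
    (Lagrange.basis S id μ - Lagrange.basis T id μ).eval ν = 0 := by
  rw [eval_sub]
  rcases eq_or_ne μ ν with rfl | h
  · have h1 := Lagrange.eval_basis_self (v := id) Function.injective_id.injOn hμ
    have h2 := Lagrange.eval_basis_self (v := id) Function.injective_id.injOn (hST hμ)
    rw [id_eq] at h1 h2
    rw [h1, h2, sub_self]
  · have h1 := Lagrange.eval_basis_of_ne (v := id) h hν
    have h2 := Lagrange.eval_basis_of_ne (v := id) h (hST hν)
    rw [id_eq] at h1 h2
    rw [h1, h2, sub_self]

/-- The span of the eigenvectors of a derivation, as a subalgebra. -/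
def eigenSubalgebra {A : Type*} [CommRing A] [Algebra K A] (D : Derivation K A A) :
    Subalgebra K A :=
  (Submodule.span K {a : A | ∃ c : K, D a = c • a}).toSubalgebra
    (Submodule.subset_span ⟨0, by simp⟩) (by
      intro x y hx hy
      have hxy := Submodule.mul_mem_mul hx hy
      rw [Submodule.span_mul_span] at hxy
      refine Submodule.span_mono ?_ hxy
      rintro _ ⟨a, ⟨c, hc⟩, b, ⟨d, hd⟩, rfl⟩
      refine ⟨c + d, ?_⟩
      change D (a * b) = _ • (a * b)
      rw [D.leibniz, hc, hd, smul_eq_mul, smul_eq_mul, mul_smul_comm, mul_smul_comm, mul_comm b,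
        ← add_smul, add_comm])

/-- Conversely, the Lagrange polynomials with nodes `S` split `x` into eigenvectors. The condition
on polynomials is the form that survives reduction modulo m^k. -/
lemma mem_eigenSubalgebra_iff {A : Type*} [CommRing A] [Algebra K A] {D : Derivation K A A}
    {x : A} : x ∈ eigenSubalgebra D ↔ ∃ S : Finset K, ∀ p : K[X], (∀ μ ∈ S, p.eval μ = 0) →
      aeval (D : Module.End K A) p x = 0 := by
  classical
  constructor
  · intro hx
    change x ∈ Submodule.span K _ at hx
    induction hx using Submodule.span_induction with
    | mem a ha =>
      obtain ⟨c, hc⟩ := ha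
      refine ⟨{c}, fun p hp => ?_⟩
      refine aeval_apply_eq_zero_of_dvd
        (dvd_iff_isRoot.2 (hp c (Finset.mem_singleton_self c))) ?_
      simp [hc, Module.algebraMap_end_apply]
    | zero => exact ⟨∅, fun p _ => map_zero _⟩
    | add a b _ _ ha hb =>
      obtain ⟨S, hS⟩ := ha
      obtain ⟨T, hT⟩ := hb
      refine ⟨S ∪ T, fun p hp => ?_⟩
      rw [map_add, hS p fun μ h => hp μ (Finset.mem_union_left _ h),
        hT p fun μ h => hp μ (Finset.mem_union_right _ h), add_zero]
    | smul c a _ ha =>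
      obtain ⟨S, hS⟩ := ha
      exact ⟨S, fun p hp => by rw [map_smul, hS p hp, smul_zero]⟩
  · rintro ⟨S, hS⟩
    have h1 := hS (∑ μ ∈ S, Lagrange.basis S id μ - 1)
      fun ν hν => eval_sum_lagrangeBasis_sub_one S hν
    rw [map_sub, map_one, LinearMap.sub_apply, sub_eq_zero, map_sum, LinearMap.sum_apply] at h1
    change _ = x at h1
    rw [← h1]
    refine Submodule.sum_mem _ fun μ _ => Submodule.subset_span ⟨μ, ?_⟩
    have h2 := hS ((X - C μ) * Lagrange.basis S id μ)
      fun ν hν => eval_X_sub_C_mul_lagrangeBasis S μ hν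
    rw [map_mul, Module.End.mul_apply, map_sub, aeval_X, aeval_C, LinearMap.sub_apply,
      Module.algebraMap_end_apply, sub_eq_zero] at h2
    exact h2

lemma dvd_of_eval_roots_eq_zero [PerfectField K] [DecidableEq K] {q : K[X]} (hq : Squarefree q) (hs : q.Splits)
    {p : K[X]} (h : ∀ μ ∈ q.roots.toFinset, p.eval μ = 0) : q ∣ p := by
  rcases eq_or_ne p 0 with rfl | hp
  · exact dvd_zero q
  refine hs.dvd_of_roots_le_roots hq.ne_zero ?_
  rw [Multiset.le_iff_subset (nodup_roots (PerfectField.separable_iff_squarefree.2 hq))]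
  intro μ hμ
  exact (mem_roots hp).2 (h μ (Multiset.mem_toFinset.2 hμ))

end General

open MvPowerSeries

variable {n : ℕ} {K : Type*} [Field K]

lemma exists_finset_aeval_mem_pow [CharZero K] {B : Matrix (Fin n) (Fin n) K} {q : K[X]}
    (hq : Squarefree q) (hs : q.Splits) (hB : aeval B q = 0) (k : ℕ) :
    ∃ S : Finset K, ∀ p : K[X], (∀ μ ∈ S, p.eval μ = 0) → ∀ φ,
      aeval (lieDerivation (linearField B) : Module.End K (MvPowerSeries (Fin n) K)) p φ ∈
        augIdeal n K ^ k := by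
  classical
  have hX : ∀ i, (MvPowerSeries.X i : MvPowerSeries (Fin n) K) ∈
      eigenSubalgebra (lieDerivation (linearField B)) := fun i =>
    mem_eigenSubalgebra_iff.2 ⟨q.roots.toFinset, fun p hp =>
      aeval_apply_eq_zero_of_dvd (dvd_of_eval_roots_eq_zero hq hs hp) (aeval_lieDerivation_X hB i)⟩
  choose S hS using fun d => mem_eigenSubalgebra_iff.1 (monomial_mem_of_X_mem _ hX d)
  refine ⟨(Finsupp.finite_of_degree_lt (σ := Fin n) k).toFinset.biUnion S, fun p hp φ => ?_⟩
  have hD := lieDerivation_mem_augIdeal (constantCoeff_linearField B)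
  have h := aeval_apply_mem_ideal (I := augIdeal n K ^ k)
    (E := (lieDerivation (linearField B) : Module.End K (MvPowerSeries (Fin n) K)))
    (fun _ hψ => derivation_mem_pow hD hψ) p (sub_sum_monomial_mem_pow k φ)
  rw [map_sub, map_sum, Finset.sum_eq_zero, sub_zero] at h
  · exact h
  · intro d hd
    rw [map_smul, hS d p fun μ hμ => hp μ (Finset.mem_biUnion.2 ⟨d, hd, hμ⟩), smul_zero]

/-- Nested node sets make the projections at successive levels compatible. -/
lemma exists_monotone_finset_aeval_mem_pow [CharZero K] {B : Matrix (Fin n) (Fin n) K} {q : K[X]}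
    (hq : Squarefree q) (hs : q.Splits) (hB : aeval B q = 0) :
    ∃ T : ℕ → Finset K, Monotone T ∧ ∀ k, ∀ p : K[X], (∀ μ ∈ T k, p.eval μ = 0) → ∀ φ,
      aeval (lieDerivation (linearField B) : Module.End K (MvPowerSeries (Fin n) K)) p φ ∈
        augIdeal n K ^ k := by
  classical
  choose S hS using exists_finset_aeval_mem_pow hq hs hB
  refine ⟨fun k => (Finset.range (k + 1)).biUnion S, fun j k hjk => ?_, fun k p hp => ?_⟩
  · exact Finset.biUnion_subset_biUnion_of_subset_left _ (Finset.range_mono (by omega))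
  · exact hS k p fun μ hμ => hp μ (Finset.mem_biUnion.2 ⟨k, Finset.self_mem_range_succ k, hμ⟩)

/-- Weight components of a power series with respect to a derivation that is diagonalizable modulo
each power of the maximal ideal. -/
lemma exists_eigenvector_sub_mem_pow [CharZero K] [DecidableEq K]
    {D : Derivation K (MvPowerSeries (Fin n) K) (MvPowerSeries (Fin n) K)}
    (hD : ∀ φ, D φ ∈ augIdeal n K) {T : ℕ → Finset K} (hmono : Monotone T)
    (hT : ∀ k, ∀ p : K[X], (∀ μ ∈ T k, p.eval μ = 0) → ∀ φ,
      aeval (D : Module.End K (MvPowerSeries (Fin n) K)) p φ ∈ augIdeal n K ^ k)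
    {c : K} (hc : ∀ k, c ∈ T k) (φ : MvPowerSeries (Fin n) K) :
    ∃ ψ, D ψ = c • ψ ∧ ∀ k, ψ - aeval (D : Module.End K (MvPowerSeries (Fin n) K))
      (Lagrange.basis (T k) id c) φ ∈ augIdeal n K ^ k := by
  -- The coefficient at `d` is read at level `d.degree + 1`, the first one modulo which it is
  -- determined.
  let ψ : MvPowerSeries (Fin n) K := fun d => MvPowerSeries.coeff d
    (aeval (D : Module.End K (MvPowerSeries (Fin n) K)) (Lagrange.basis (T (d.degree + 1)) id c) φ)
  have hψ : ∀ k, ψ - aeval (D : Module.End K (MvPowerSeries (Fin n) K))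
      (Lagrange.basis (T k) id c) φ ∈ augIdeal n K ^ k := by
    intro k
    rw [mem_pow_iff]
    intro d hd
    have h := hT (d.degree + 1) _
      (fun ν hν => eval_lagrangeBasis_sub (hmono (Nat.succ_le_of_lt hd)) (hc _) hν) φ
    rw [map_sub, LinearMap.sub_apply] at h
    have h2 := coeff_eq_zero_of_mem_pow h (Nat.lt_succ_self _)
    rwa [map_sub] at h2 ⊢
  refine ⟨ψ, ?_, hψ⟩
  rw [← sub_eq_zero]
  refine eq_zero_of_forall_mem_pow fun k => ?_
  have h1 := hT k _ (fun ν hν => eval_X_sub_C_mul_lagrangeBasis (T k) c hν) φ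
  rw [map_mul, Module.End.mul_apply, map_sub, aeval_X, aeval_C, LinearMap.sub_apply,
    Module.algebraMap_end_apply] at h1
  have h2 := derivation_mem_pow hD (hψ k)
  have h3 : c • (ψ - aeval (D : Module.End K (MvPowerSeries (Fin n) K))
      (Lagrange.basis (T k) id c) φ) ∈ augIdeal n K ^ k := by
    rw [MvPowerSeries.smul_eq_C_mul]
    exact Ideal.mul_mem_left _ _ (hψ k)
  have h4 := add_mem (sub_mem h2 h3) h1
  rw [map_sub, smul_sub] at h4
  convert! h4 using 1
  rw [Derivation.coeFn_coe]
  abel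

/-- An invariant ideal of a diagonalizable linear vector field is generated by eigenvectors. -/
theorem generatedBySemiInvariants_of_isInvariant [CharZero K] {B : Matrix (Fin n) (Fin n) K}
    {q : K[X]} (hq : Squarefree q) (hs : q.Splits) (hB : aeval B q = 0)
    {I : Ideal (MvPowerSeries (Fin n) K)} (hI : IsInvariant (linearField B) I) :
    GeneratedBySemiInvariants (linearField B) I := by
  classical
  obtain ⟨T, hmono, hT⟩ := exists_monotone_finset_aeval_mem_pow hq hs hB
  have hD := lieDerivation_mem_augIdeal (constantCoeff_linearField B)
  let s : Set (MvPowerSeries (Fin n) K) :=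
    {ψ | ψ ∈ I ∧ ∃ c : K, lieDerivation (linearField B) ψ = c • ψ}
  have hIs : Ideal.span s = I := by
    refine le_antisymm (Ideal.span_le.2 fun ψ hψ => hψ.1) fun φ hφ => ?_
    refine mem_of_forall_mem_sup_pow fun k => ?_
    -- Starting the node sets at level `k` puts every `c ∈ T k` in all of them.
    have hmono' : Monotone fun j => T (max j k) := fun i j hij =>
      hmono (max_le_max_right k hij)
    have hT' : ∀ j, ∀ p : K[X], (∀ μ ∈ T (max j k), p.eval μ = 0) → ∀ φ,
        aeval (lieDerivation (linearField B) : Module.End K (MvPowerSeries (Fin n) K)) p φ ∈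
          augIdeal n K ^ j := fun j p hp φ =>
      hT j p (fun μ hμ => hp μ (hmono (le_max_left j k) hμ)) φ
    have hsum := hT k _ (fun ν hν => eval_sum_lagrangeBasis_sub_one (T k) hν) φ
    rw [map_sub, map_one, LinearMap.sub_apply, Module.End.one_apply, map_sum,
      LinearMap.sum_apply] at hsum
    rw [← sub_sub_cancel (∑ c ∈ T k, aeval (lieDerivation (linearField B) :
      Module.End K (MvPowerSeries (Fin n) K)) (Lagrange.basis (T k) id c) φ) φ]
    refine sub_mem (Ideal.sum_mem _ fun c hc => ?_) (Ideal.mem_sup_right hsum)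
    obtain ⟨ψ, hψ, hψk⟩ := exists_eigenvector_sub_mem_pow hD hmono' hT'
      (fun j => hmono (le_max_right j k) hc) φ
    -- `ψ` is an adic limit of polynomials in `L_B` applied to `φ`, all of which lie in `I`.
    have hψI : ψ ∈ I := by
      refine mem_of_forall_mem_sup_pow fun j => ?_
      rw [← sub_add_cancel ψ (aeval (lieDerivation (linearField B) :
        Module.End K (MvPowerSeries (Fin n) K)) (Lagrange.basis (T (max j k)) id c) φ)]
      exact add_mem (Ideal.mem_sup_right (hψk j))
        (Ideal.mem_sup_left (hI.aeval_mem _ hφ))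
    have h5 := hψk k
    rw [max_self] at h5
    rw [← sub_sub_cancel ψ (aeval (lieDerivation (linearField B) :
        Module.End K (MvPowerSeries (Fin n) K)) (Lagrange.basis (T k) id c) φ)]
    exact sub_mem (Ideal.mem_sup_left (Ideal.subset_span ⟨hψI, c, hψ⟩)) (Ideal.mem_sup_right h5)
  obtain ⟨t, hts, ht⟩ := (Submodule.fg_span_iff_fg_span_finset_subset s).1
    (IsNoetherian.noetherian (Ideal.span s))
  have ht' : Ideal.span s = Ideal.span (t : Set (MvPowerSeries (Fin n) K)) := ht
  choose c hc using fun j : Fin t.card => (hts (t.equivFin.symm j).2).2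
  refine ⟨t.card, fun j => (t.equivFin.symm j : MvPowerSeries (Fin n) K),
    fun j => MvPolynomial.C (c j), ?_, fun j => ?_⟩
  · rw [← hIs, ht']
    congr 1
    ext x
    constructor
    · intro hx
      exact ⟨t.equivFin ⟨x, hx⟩, by simp⟩
    · rintro ⟨j, rfl⟩
      exact (t.equivFin.symm j).2
  · rw [← lieDerivation_apply, hc j, MvPolynomial.coe_C, MvPowerSeries.smul_eq_C_mul]

/-! ### Base change along a field embedding. -/

lemma map_lieDeriv_linearField {L : Type*} [Field L] (σ : K →+* L) (B : Matrix (Fin n) (Fin n) K)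
    (φ : MvPowerSeries (Fin n) K) :
    MvPowerSeries.map σ (lieDeriv (linearField B) φ) =
      lieDeriv (linearField (B.map σ)) (MvPowerSeries.map σ φ) := by
  have hp : ∀ i, MvPowerSeries.map σ (pderiv K i φ) = pderiv L i (MvPowerSeries.map σ φ) := by
    intro i
    ext d
    simp [coeff_pderiv]
  simp [lieDeriv, linearField, hp]

lemma IsInvariant.map {L : Type*} [Field L] (σ : K →+* L) {B : Matrix (Fin n) (Fin n) K}
    {I : Ideal (MvPowerSeries (Fin n) K)} (hI : IsInvariant (linearField B) I) :
    IsInvariant (linearField (B.map σ)) (I.map (MvPowerSeries.map σ)) := by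
  intro φ hφ
  rw [← lieDerivation_apply]
  refine Submodule.span_induction ?_ ?_ ?_ ?_ hφ
  · rintro _ ⟨ψ, hψ, rfl⟩
    rw [lieDerivation_apply, ← map_lieDeriv_linearField]
    exact Ideal.mem_map_of_mem _ (hI ψ hψ)
  · rw [map_zero]
    exact zero_mem _
  · intro x y _ _ hx hy
    rw [map_add]
    exact add_mem hx hy
  · intro a x hx' hx
    rw [smul_eq_mul, Derivation.leibniz, smul_eq_mul, smul_eq_mul]
    exact add_mem (Ideal.mul_mem_left _ _ hx) (Ideal.mul_mem_right _ _ hx')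

lemma aeval_map_minpoly_eq_zero {L : Type*} [Field L] (σ : K →+* L)
    (B : Matrix (Fin n) (Fin n) K) : aeval (B.map σ) ((minpoly K B).map σ) = 0 := by
  have h : σ.mapMatrix.comp (algebraMap K (Matrix (Fin n) (Fin n) K)) =
      (algebraMap L (Matrix (Fin n) (Fin n) L)).comp σ := by
    ext a i j
    simp [Matrix.algebraMap_matrix_apply, apply_ite σ]
  rw [aeval_def, eval₂_map, ← h]
  change eval₂ _ (σ.mapMatrix B) _ = 0
  rw [← hom_eval₂, ← aeval_def, minpoly.aeval, map_zero]

end FormalVF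

end

theorem theorem2 {K : Type*} [RCLike K] {n : ℕ}
    (f : FormalVF.VectorField n K) (Bs : Matrix (Fin n) (Fin n) K)
    (hf : FormalVF.IsPDNF f Bs)
    (I : Ideal (MvPowerSeries (Fin n) K)) (hI : FormalVF.IsInvariant f I) :
    FormalVF.IsInvariant (FormalVF.linearField Bs) I ∧
    (Bs.charpoly.Splits →
      FormalVF.GeneratedBySemiInvariants (FormalVF.linearField Bs) I) ∧
    (∀ σ : K →+* ℂ,
      FormalVF.GeneratedBySemiInvariants (FormalVF.linearField (Bs.map σ))
        (I.map (MvPowerSeries.map σ))) := by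
  have hinv := hf.isInvariant_linearField hI
  have hsq : Squarefree (minpoly K Bs) := by
    rw [← Matrix.minpoly_toLin']
    exact hf.semisimplePart.semisimple.minpoly_squarefree
  refine ⟨hinv, fun hs => ?_, fun σ => ?_⟩
  · exact FormalVF.generatedBySemiInvariants_of_isInvariant hsq
      (hs.of_dvd (Matrix.charpoly_monic Bs).ne_zero (Matrix.minpoly_dvd_charpoly Bs))
      (minpoly.aeval K Bs) hinv
  -- Squarefreeness passes to the larger field by way of separability, which every field embedding
  -- preserves.
  · exact FormalVF.generatedBySemiInvariants_of_isInvariant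
      (PerfectField.separable_iff_squarefree.2 hsq).map.squarefree
      (IsAlgClosed.splits _) (FormalVF.aeval_map_minpoly_eq_zero σ Bs) (hinv.map σ)
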